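/- Let $X$ be a (real or complex) Hilbert space and let $M,N\subseteq X$ be nonempty bounded closed convex sets. For a nonempty closed convex set $C\subseteq X$ let $P_C(x)$ denote the unique point of $C$ nearest to $x\in X$, and put $P(x)=P_M(P_N(x))$ for $x\in X$, with iterates $P^0=\mathrm{id}$ and $P^{n+1}=P\circ P^n$. Let $F:M\cup N\to M\cup N$ satisfy 1. $F(M)\subseteq M$ and $F(N)\subseteq N$; 2. $\|Fw-Fz\|\le\|w-z\|$ for all $w\in M$ and $z\in N$. Let $\epsilon\in(0,\tfrac12)$, let $\eta_n,\delta_n\in(\epsilon,1-\epsilon)$ for $n=0,1,2,\dots$, let $w_0\in M$, and define, for $n=0,1,2,\dots$, $$z_n=(1-\delta_n)w_n+\delta_nFw_n,\qquad w_{n+1}=P^n\big((1-\eta_n)w_n+\eta_nFz_n\big).$$ Then $\lim_{n\to\infty}\|w_n-Fw_n\|=0$. Moreover, if $F(M)$ is contained in a compact set and $\|w_n-Fz_n\|\to0$, then $(w_n)$ converges in norm to a fixed point of $F$ (which lies in $M$). -/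

import Mathlib

open Filter Topology

/-- The set of nearest points `P_M(w) = {z ∈ M : ‖w - z‖ = d(w, M)}` of `M` to `w`. -/
def nearestPoints {X : Type*} [NormedAddCommGroup X] (M : Set X) (w : X) : Set X :=
  {z | z ∈ M ∧ ‖w - z‖ = Metric.infDist w M}

open Classical in
/-- The metric projection onto `M`, as a single-valued map: the nearest point of `M` to `w`.
For `M` nonempty closed convex in a Hilbert space the nearest point exists and is unique,
see `nearestPoints_eq_singleton`; the value where there is no nearest point is irrelevant. -/
noncomputable def metricProj {X : Type*} [NormedAddCommGroup X] (M : Set X) (w : X) : X :=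
  if h : (nearestPoints M w).Nonempty then h.some else w

/-- The alternating projection operator `P = P_M ∘ P_N`. Its iterates `P^[n] w` form the
von Neumann sequence of `w`. -/
noncomputable def altProj {X : Type*} [NormedAddCommGroup X] (M N : Set X) (w : X) : X :=
  metricProj M (metricProj N w)

/-- A map `F` on `M ∪ N` is relatively nonexpansive if `‖F w - F z‖ ≤ ‖w - z‖` for all
`w ∈ M` and `z ∈ N`. Only the values of `F` on `M ∪ N` enter. -/
def RelativelyNonexpansive {X : Type*} [NormedAddCommGroup X] (M N : Set X) (F : X → X) : Prop :=
  ∀ w ∈ M, ∀ z ∈ N, ‖F w - F z‖ ≤ ‖w - z‖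

/-- In a (real or complex) Hilbert space, the nearest point to `w` in a nonempty closed convex set
exists and is unique, and `metricProj` is that point. -/
theorem nearestPoints_eq_singleton (𝕜 : Type*) [RCLike 𝕜] {X : Type*} [NormedAddCommGroup X]
    [InnerProductSpace 𝕜 X] [NormedSpace ℝ X] [IsScalarTower ℝ 𝕜 X] [CompleteSpace X]
    {M : Set X} (hne : M.Nonempty) (hcl : IsClosed M) (hcv : Convex ℝ M) (w : X) :
    nearestPoints M w = {metricProj M w} := by
  let _ : InnerProductSpace ℝ X :=
    { (inferInstance : NormedSpace ℝ X) with
      inner := fun x y => RCLike.re (inner 𝕜 x y)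
      norm_sq_eq_re_inner := fun x => by
        simp
      conj_inner_symm := fun x y => by
        simpa using inner_re_symm (𝕜 := 𝕜) y x
      add_left := fun x y z => by simp [inner_add_left]
      smul_left := fun x y r => by
        rw [← algebraMap_smul 𝕜 r x, inner_smul_left]
        simp [RCLike.algebraMap_eq_ofReal] }
  have hid : Metric.infDist w M = ⨅ z : M, ‖w - z‖ := by
    rw [Metric.infDist_eq_iInf]
    simp only [dist_eq_norm]
  have hex : (nearestPoints M w).Nonempty := by
    obtain ⟨v, hv, hvw⟩ := exists_norm_eq_iInf_of_complete_convex hne hcl.isComplete hcv w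
    exact ⟨v, hv, by rw [hid, hvw]⟩
  have hmem : metricProj M w ∈ nearestPoints M w := by
    rw [metricProj, dif_pos hex]
    exact hex.some_mem
  refine Set.eq_singleton_iff_unique_mem.2 ⟨hmem, fun z hz => ?_⟩
  set p := metricProj M w
  have h1 := (norm_eq_iInf_iff_real_inner_le_zero hcv hmem.1).1 (hmem.2.trans hid) z hz.1
  have h2 := (norm_eq_iInf_iff_real_inner_le_zero hcv hz.1).1 (hz.2.trans hid) p hmem.1
  have h3 : inner ℝ (z - p) (z - p) ≤ 0 := by
    have e : inner ℝ (z - p) (z - p) = inner ℝ (w - p) (z - p) + inner ℝ (w - z) (p - z) := by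
      rw [← neg_sub z p, inner_neg_right, ← sub_eq_add_neg, ← inner_sub_left]
      congr 1
      abel
    linarith
  exact sub_eq_zero.1 (real_inner_self_nonpos.1 h3)

/-!
The argument is Fejér monotonicity with respect to a suitable fixed point of `F` in `N`.

Call `(p, q) ∈ M × N` a proximal pair if it realises the distance of `M` and `N`; the difference
`q - p` is then the same for all such pairs. Suppose `F q = q`. Relative nonexpansiveness says that
`F` does not increase the distance of points of `M` to `q`, and the identity for
`‖(1 - t) a + t b - q‖²` turns the two convex combinations of the iteration into the estimate
`‖u - q‖² ≤ ‖w - q‖² - s t (1 - t) ‖w - F w‖²` (`norm_ishikawa_sub_sq_le`). The operator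
`P = P_M P_N` does not increase the distance of points of `M` to `q` either, although `q` need not
lie in `M`, and it gains a square (`IsProximalPair.norm_altProj_sub_sq_add_le`). So `‖w n - q‖²`
decreases, and its increments control `‖w n - F (w n)‖²`, which therefore tends to zero.

The pair `(p, q)` comes from the fixed point theorem of Browder, Göhde and Kirk
(`exists_fixedPoint_of_lipschitzOnWith_one`), used twice: a fixed point of `P` in `M` is the left
point of a proximal pair, and on the closed convex set of all such left points `F` is nonexpansive
by the parallelogram-type cancellation in `exists_isProximalPair_fixed`.

For the convergence of `w`, the squares gained in the `n` applications of `P` at the `n`-th step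
show that the distance of `w n` to `N` tends to that of `M` to `N`. Hence every subsequential limit
`a` of `w` belongs to a proximal pair `(a, b)`. Both points are fixed by `F`, so `‖w n - b‖`
decreases to `‖a - b‖`; as `a` is the projection of `b` to `M`, this forces `w n → a`
(`exists_fixedPoint_tendsto_of_fejer`). Compactness serves only to provide such a limit.
-/

section RealHilbert

variable {X : Type*} [NormedAddCommGroup X] [InnerProductSpace ℝ X]
variable {M N : Set X} {p q x y u : X} {F : X → X}

/-! ### Fixed points of nonexpansive maps -/

/-- The estimate behind the convergence of the approximating curve `x_t = t u + (1 - t) T x_t`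
of a nonexpansive map: with `e = x_s - u`, `f = x_t - u` the norm is monotone along the curve, and
its increments control the distance of the points. -/
lemma norm_sub_sq_le_of_resolvent {e f : X} {a b : ℝ} (hb : 0 < b) (hba : b ≤ a)
    (h : ‖(1 + a) • e - (1 + b) • f‖ ≤ ‖e - f‖) : ‖e - f‖ ^ 2 ≤ ‖f‖ ^ 2 - ‖e‖ ^ 2 := by
  have h1 : ‖(1 + a) • e - (1 + b) • f‖ ^ 2 ≤ ‖e - f‖ ^ 2 := by gcongr
  have h2 : (1 + a) • e - (1 + b) • f = (e - f) + (a • e - b • f) := by module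
  rw [h2, norm_add_sq_real] at h1
  have h3 : inner ℝ (e - f) (a • e - b • f)
      = b * ‖e - f‖ ^ 2 + (a - b) * inner ℝ (e - f) e := by
    rw [← real_inner_self_eq_norm_sq, ← inner_smul_right, ← inner_smul_right, ← inner_add_right]
    congr 1
    module
  have h4 : b * ‖e - f‖ ^ 2 + (a - b) * inner ℝ (e - f) e ≤ 0 := by
    nlinarith [sq_nonneg ‖a • e - b • f‖]
  have h5 : ‖f‖ ^ 2 = ‖e‖ ^ 2 - 2 * inner ℝ (e - f) e + ‖e - f‖ ^ 2 := by
    have : f = e - (e - f) := by abel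
    conv_lhs => rw [this]
    rw [norm_sub_sq_real, real_inner_comm]
  rcases hba.eq_or_lt with rfl | hlt
  · have : ‖e - f‖ ^ 2 ≤ 0 := by
      have : b * ‖e - f‖ ^ 2 ≤ 0 := by linarith
      exact nonpos_of_mul_nonpos_right this hb
    have h6 : e = f := by
      rw [← sub_eq_zero, ← norm_eq_zero]
      exact pow_eq_zero_iff two_ne_zero |>.1 (le_antisymm this (sq_nonneg _))
    simp [h6]
  · have h6 : inner ℝ (e - f) e ≤ 0 := by
      refine nonpos_of_mul_nonpos_right ?_ (sub_pos.2 hlt)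
      nlinarith [mul_nonneg hb.le (sq_nonneg ‖e - f‖)]
    linarith

/-- The fixed point theorem of Browder, Göhde and Kirk in a Hilbert space. -/
theorem exists_fixedPoint_of_lipschitzOnWith_one [CompleteSpace X] {C : Set X}
    (hne : C.Nonempty) (hbd : Bornology.IsBounded C) (hcl : IsClosed C) (hcv : Convex ℝ C)
    {T : X → X} (hT : Set.MapsTo T C C) (hL : LipschitzOnWith 1 T C) :
    ∃ p ∈ C, T p = p := by
  obtain ⟨u, hu⟩ := hne
  -- The fixed point `x` of the contraction `t • u + (1 - t) • T ·` for `t = 1 / (n + 2)`,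
  -- which satisfies `T x - u = (1 - t)⁻¹ • (x - u)`.
  have key : ∀ n : ℕ, ∃ x ∈ C, T x - u = (1 + 1 / ((n : ℝ) + 1)) • (x - u) := by
    intro n
    set t : ℝ := 1 / ((n : ℝ) + 2) with ht
    have hn : (0 : ℝ) ≤ n := n.cast_nonneg
    have ht0 : 0 < t := by positivity
    have ht1 : t < 1 := by rw [ht, div_lt_one (by positivity)]; linarith
    set S : X → X := fun x => t • u + (1 - t) • T x with hS
    have hmap : Set.MapsTo S C C := fun x hx =>
      hcv hu (hT hx) ht0.le (by linarith) (by ring)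
    have hlip : ContractingWith (1 - t).toNNReal (hmap.restrict S C C) := by
      refine ⟨by rw [Real.toNNReal_lt_one]; linarith, ?_⟩
      refine LipschitzWith.of_dist_le_mul fun x y => ?_
      have h1 : dist (T x) (T y) ≤ dist (x : X) y := by
        simpa using hL.dist_le_mul x x.2 y y.2
      rw [Real.coe_toNNReal _ (by linarith)]
      change dist (S x) (S y) ≤ (1 - t) * dist (x : X) y
      have h2 : S x - S y = (1 - t) • (T x - T y) := by simp only [hS]; module
      rw [dist_eq_norm, h2, norm_smul, Real.norm_of_nonneg (by linarith), ← dist_eq_norm]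
      exact mul_le_mul_of_nonneg_left h1 (by linarith)
    obtain ⟨x, hx, hfix, -⟩ := hlip.exists_fixedPoint' hcl.isComplete hmap hu (edist_ne_top _ _)
    refine ⟨x, hx, ?_⟩
    have h3 : t • u + (1 - t) • T x = x := hfix
    have h4 : (1 - t) • (T x - u) = x - u := by
      nth_rewrite 2 [← h3]; module
    rw [← h4, smul_smul]
    have : (1 + 1 / ((n : ℝ) + 1)) * (1 - t) = 1 := by
      rw [ht]; field_simp; ring
    rw [this, one_smul]
  choose x hxC hx using key
  have hmono : ∀ n m, n ≤ m → ‖x n - x m‖ ^ 2 ≤ ‖x m - u‖ ^ 2 - ‖x n - u‖ ^ 2 := by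
    intro n m hnm
    have h1 : ‖x n - x m‖ = ‖(x n - u) - (x m - u)‖ := by congr 1; abel
    rw [h1]
    refine norm_sub_sq_le_of_resolvent (a := 1 / ((n : ℝ) + 1)) (b := 1 / ((m : ℝ) + 1))
      (by positivity) (by gcongr) ?_
    rw [← hx, ← hx, ← h1, sub_sub_sub_cancel_right]
    simpa [dist_eq_norm] using hL.dist_le_mul _ (hxC n) _ (hxC m)
  obtain ⟨R, hR⟩ := hbd.exists_norm_le
  have hbdd : ∀ n, ‖x n - u‖ ≤ R + R := fun n =>
    (norm_sub_le _ _).trans (add_le_add (hR _ (hxC n)) (hR _ hu))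
  have hcauR : CauchySeq fun n => ‖x n - u‖ ^ 2 := by
    refine (tendsto_atTop_ciSup (f := fun n => ‖x n - u‖ ^ 2) ?_ ?_).cauchySeq
    · intro n m hnm
      have := hmono n m hnm
      change ‖x n - u‖ ^ 2 ≤ ‖x m - u‖ ^ 2
      nlinarith [sq_nonneg ‖x n - x m‖]
    · refine ⟨(R + R) ^ 2, ?_⟩
      rintro _ ⟨n, rfl⟩
      exact pow_le_pow_left₀ (norm_nonneg _) (hbdd n) 2
  have hcau : CauchySeq x := by
    rw [Metric.cauchySeq_iff'] at hcauR ⊢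
    intro ε hε
    obtain ⟨k, hk⟩ := hcauR (ε ^ 2) (by positivity)
    refine ⟨k, fun n hn => ?_⟩
    have h1 := hk n hn
    rw [Real.dist_eq] at h1
    have h2 := hmono k n hn
    rw [dist_comm, dist_eq_norm]
    exact lt_of_pow_lt_pow_left₀ 2 hε.le (h2.trans_lt ((le_abs_self _).trans_lt h1))
  obtain ⟨p, hp⟩ := cauchySeq_tendsto_of_complete hcau
  have hpC : p ∈ C := hcl.mem_of_tendsto hp (Eventually.of_forall hxC)
  refine ⟨p, hpC, ?_⟩
  have hT1 : Tendsto (fun n => T (x n)) atTop (𝓝 (T p)) := by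
    have : Tendsto x atTop (𝓝[C] p) :=
      tendsto_nhdsWithin_iff.2 ⟨hp, Eventually.of_forall hxC⟩
    exact (hL.continuousOn p hpC).tendsto.comp this
  have hT2 : Tendsto (fun n => T (x n)) atTop (𝓝 p) := by
    have h1 : ∀ n, T (x n) = u + (1 + 1 / ((n : ℝ) + 1)) • (x n - u) := fun n => by
      rw [← hx n]; abel
    simp_rw [h1]
    have h2 : Tendsto (fun n : ℕ => (1 + 1 / ((n : ℝ) + 1))) atTop (𝓝 (1 + 0)) :=
      tendsto_one_div_add_atTop_nhds_zero_nat.const_add 1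
    have h3 := (h2.smul (hp.sub_const u)).const_add u
    simpa using h3
  exact tendsto_nhds_unique hT1 hT2

/-! ### Metric projections -/

section Projection
variable [CompleteSpace X]

lemma metricProj_mem_nearestPoints (hne : N.Nonempty) (hcl : IsClosed N) (hcv : Convex ℝ N)
    (x : X) : metricProj N x ∈ nearestPoints N x := by
  rw [nearestPoints_eq_singleton ℝ hne hcl hcv x]
  rfl

lemma inner_sub_metricProj_nonpos (hne : N.Nonempty) (hcl : IsClosed N) (hcv : Convex ℝ N)
    (x : X) (hy : y ∈ N) : inner ℝ (x - metricProj N x) (y - metricProj N x) ≤ 0 := by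
  obtain ⟨h1, h2⟩ := metricProj_mem_nearestPoints hne hcl hcv x
  have hid : Metric.infDist x N = ⨅ z : N, ‖x - z‖ := by
    rw [Metric.infDist_eq_iInf]
    simp only [dist_eq_norm]
  exact (norm_eq_iInf_iff_real_inner_le_zero hcv h1).1 (h2.trans hid) y hy

lemma lipschitzWith_metricProj (hne : N.Nonempty) (hcl : IsClosed N) (hcv : Convex ℝ N) :
    LipschitzWith 1 (metricProj N) := by
  refine LipschitzWith.of_dist_le_mul fun x y => ?_
  have hx := inner_sub_metricProj_nonpos hne hcl hcv x
    (metricProj_mem_nearestPoints hne hcl hcv y).1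
  have hy := inner_sub_metricProj_nonpos hne hcl hcv y
    (metricProj_mem_nearestPoints hne hcl hcv x).1
  rw [NNReal.coe_one, one_mul, dist_eq_norm, dist_eq_norm]
  set a := metricProj N x
  set b := metricProj N y
  have h : ‖a - b‖ ^ 2 ≤ inner ℝ (x - y) (a - b) := by
    rw [← real_inner_self_eq_norm_sq]
    simp only [inner_sub_left, inner_sub_right] at hx hy ⊢
    linarith
  have h2 := real_inner_le_norm (x - y) (a - b)
  by_contra! hlt
  nlinarith [norm_nonneg (x - y), norm_nonneg (a - b)]

end Projection

/-! ### Proximal pairs -/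

/-- `(p, q) ∈ M × N` is a proximal pair if each point is nearest to the other in its set. This is
encoded by the variational inequalities: `M` and `N` lie on different sides of the slab orthogonal
to `q - p` with `p` and `q` on its two faces. Such a pair realises the distance of `M` and `N`, see
`IsProximalPair.norm_le`. -/
structure IsProximalPair (M N : Set X) (p q : X) : Prop where
  mem_left : p ∈ M
  mem_right : q ∈ N
  inner_left : ∀ x ∈ M, inner ℝ (q - p) (x - p) ≤ 0
  inner_right : ∀ y ∈ N, 0 ≤ inner ℝ (q - p) (y - q)

namespace IsProximalPair

lemma norm_sq_le_inner (h : IsProximalPair M N p q) (hx : x ∈ M) (hy : y ∈ N) :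
    ‖q - p‖ ^ 2 ≤ inner ℝ (q - p) (y - x) := by
  have h1 := h.inner_left x hx
  have h2 := h.inner_right y hy
  have h3 : y - x = (y - q) - (x - p) + (q - p) := by abel
  rw [h3, inner_add_right, inner_sub_right, real_inner_self_eq_norm_sq]
  linarith

lemma norm_le (h : IsProximalPair M N p q) (hx : x ∈ M) (hy : y ∈ N) :
    ‖q - p‖ ≤ ‖y - x‖ := by
  have h1 := h.norm_sq_le_inner hx hy
  have h2 := real_inner_le_norm (q - p) (y - x)
  by_contra! hlt
  nlinarith [norm_nonneg (q - p), norm_nonneg (y - x)]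

/-- All pairs that realise the distance of `M` and `N` have the same difference. -/
lemma sub_eq (h : IsProximalPair M N p q) (hx : x ∈ M) (hy : y ∈ N) (hxy : ‖y - x‖ ≤ ‖q - p‖) :
    y - x = q - p := by
  have h1 := h.norm_sq_le_inner hx hy
  have h2 : ‖(y - x) - (q - p)‖ ^ 2 ≤ 0 := by
    rw [norm_sub_sq_real, real_inner_comm]
    nlinarith [norm_nonneg (y - x)]
  rw [← sub_eq_zero, ← norm_eq_zero]
  exact pow_eq_zero_iff two_ne_zero |>.1 (le_antisymm h2 (sq_nonneg _))

lemma of_norm_le (h : IsProximalPair M N p q) (hx : x ∈ M) (hy : y ∈ N)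
    (hxy : ‖y - x‖ ≤ ‖q - p‖) : IsProximalPair M N x y := by
  have e := h.sub_eq hx hy hxy
  have key : ∀ x' ∈ M, ∀ y' ∈ N, ‖y - x‖ ^ 2 ≤ inner ℝ (y - x) (y' - x') := fun x' hx' y' hy' => by
    rw [e]; exact h.norm_sq_le_inner hx' hy'
  refine ⟨hx, hy, fun x' hx' => ?_, fun y' hy' => ?_⟩
  · have h1 := key x' hx' y hy
    have h2 : y - x' = (y - x) - (x' - x) := by abel
    rw [h2, inner_sub_right, real_inner_self_eq_norm_sq] at h1
    linarith
  · have h1 := key x hx y' hy'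
    have h2 : y' - x = (y - x) + (y' - y) := by abel
    rw [h2, inner_add_right, real_inner_self_eq_norm_sq] at h1
    linarith

lemma norm_sub_sq_add_le (h : IsProximalPair M N p q) (hx : x ∈ M) :
    ‖x - p‖ ^ 2 + ‖q - p‖ ^ 2 ≤ ‖x - q‖ ^ 2 := by
  have h1 := h.inner_left x hx
  have h2 : x - q = (x - p) - (q - p) := by abel
  rw [h2, norm_sub_sq_real (x - p), real_inner_comm]
  linarith

lemma norm_le_infDist (h : IsProximalPair M N p q) (hx : x ∈ M) :
    ‖q - p‖ ≤ Metric.infDist x N := by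
  rw [Metric.le_infDist ⟨q, h.mem_right⟩]
  intro y hy
  rw [dist_comm, dist_eq_norm]
  exact h.norm_le hx hy

end IsProximalPair

/-- A fixed point of `P_M ∘ P_N` and its projection to `N` form a proximal pair. -/
theorem exists_isProximalPair [CompleteSpace X]
    (hMne : M.Nonempty) (hMbd : Bornology.IsBounded M) (hMcl : IsClosed M) (hMcv : Convex ℝ M)
    (hNne : N.Nonempty) (hNcl : IsClosed N) (hNcv : Convex ℝ N) :
    ∃ p q, IsProximalPair M N p q := by
  obtain ⟨p, hp, hfix⟩ := exists_fixedPoint_of_lipschitzOnWith_one (T := altProj M N)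
    hMne hMbd hMcl hMcv (fun x _ => (metricProj_mem_nearestPoints hMne hMcl hMcv _).1)
    (by
      rw [← mul_one (1 : NNReal)]
      exact ((lipschitzWith_metricProj hMne hMcl hMcv).comp
        (lipschitzWith_metricProj hNne hNcl hNcv)).lipschitzOnWith)
  refine ⟨p, metricProj N p, hp, (metricProj_mem_nearestPoints hNne hNcl hNcv p).1,
    fun x hx => ?_, fun y hy => ?_⟩
  · have := inner_sub_metricProj_nonpos hMne hMcl hMcv (metricProj N p) hx
    rwa [show metricProj M (metricProj N p) = p from hfix] at this
  · have := inner_sub_metricProj_nonpos hNne hNcl hNcv p hy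
    rw [← neg_sub, inner_neg_left] at this
    linarith

/-- A relatively nonexpansive map is nonexpansive on the set of left points of proximal pairs,
where it commutes with the translation to `N`; so it fixes both points of some proximal pair. -/
theorem exists_isProximalPair_fixed [CompleteSpace X]
    (hMne : M.Nonempty) (hMbd : Bornology.IsBounded M) (hMcl : IsClosed M) (hMcv : Convex ℝ M)
    (hNne : N.Nonempty) (hNcl : IsClosed N) (hNcv : Convex ℝ N)
    (hFM : Set.MapsTo F M M) (hFN : Set.MapsTo F N N) (hF : RelativelyNonexpansive M N F) :
    ∃ p q, IsProximalPair M N p q ∧ F p = p ∧ F q = q := by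
  obtain ⟨a, b, hab⟩ := exists_isProximalPair hMne hMbd hMcl hMcv hNne hNcl hNcv
  set v := b - a with hv
  have hpair : ∀ x ∈ M ∩ (fun x => x + v) ⁻¹' N, IsProximalPair M N x (x + v) := fun x hx =>
    hab.of_norm_le hx.1 hx.2 (by rw [add_sub_cancel_left])
  have hFv : ∀ x ∈ M ∩ (fun x => x + v) ⁻¹' N, F (x + v) = F x + v := fun x hx => by
    have h := (hpair x hx).sub_eq (hFM hx.1) (hFN hx.2)
      (by rw [norm_sub_rev, norm_sub_rev _ x]; exact hF _ hx.1 _ hx.2)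
    rw [add_sub_cancel_left] at h
    exact sub_eq_iff_eq_add'.1 h
  -- The inequalities for the pairs `(x, y + v)` and `(y, x + v)` have cross terms of opposite sign.
  have hlip : LipschitzOnWith 1 F (M ∩ (fun x => x + v) ⁻¹' N) := by
    refine LipschitzOnWith.of_dist_le_mul fun x hx y hy => ?_
    rw [NNReal.coe_one, one_mul, dist_eq_norm, dist_eq_norm]
    have h1 := pow_le_pow_left₀ (norm_nonneg _) (hF x hx.1 _ hy.2) 2
    have h2 := pow_le_pow_left₀ (norm_nonneg _) (hF y hy.1 _ hx.2) 2
    rw [hFv y hy, ← sub_sub, ← sub_sub, norm_sub_sq_real, norm_sub_sq_real (x - y)] at h1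
    rw [hFv x hx, ← sub_sub, ← sub_sub, ← neg_sub (F x) (F y), ← neg_sub x y, norm_sub_sq_real,
      norm_sub_sq_real (-(x - y)), inner_neg_left, inner_neg_left, norm_neg, norm_neg] at h2
    exact (sq_le_sq₀ (norm_nonneg _) (norm_nonneg _)).1 (by linarith)
  obtain ⟨p, hp, hfix⟩ := exists_fixedPoint_of_lipschitzOnWith_one
    (C := M ∩ (fun x => x + v) ⁻¹' N) (T := F)
    ⟨a, hab.mem_left, by simpa [hv] using hab.mem_right⟩
    (hMbd.subset Set.inter_subset_left)
    (hMcl.inter (hNcl.preimage (by fun_prop)))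
    (hMcv.inter (hNcv.translate_preimage_left v))
    (fun x hx => ⟨hFM hx.1, by
      change F x + v ∈ N
      rw [← hFv x hx]; exact hFN hx.2⟩) hlip
  exact ⟨p, p + v, hpair p hp, hfix, by rw [hFv p hp, hfix]⟩

/-! ### Alternating projections and proximal pairs -/

section AltProj
variable [CompleteSpace X]

lemma altProj_mem (hMne : M.Nonempty) (hMcl : IsClosed M) (hMcv : Convex ℝ M) (N : Set X) (x : X) :
    altProj M N x ∈ M :=
  (metricProj_mem_nearestPoints hMne hMcl hMcv _).1

/-- `P_M ∘ P_N` does not increase the distance of points of `M` to the right point `q` of a proximal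
pair, although `q` is not a fixed point of it in general. The decrease controls how far the last
displacement is from the optimal one, `q - p`. -/
lemma IsProximalPair.norm_altProj_sub_sq_add_le (h : IsProximalPair M N p q)
    (hMcl : IsClosed M) (hMcv : Convex ℝ M) (hNcl : IsClosed N) (hNcv : Convex ℝ N) (hx : x ∈ M) :
    ‖altProj M N x - q‖ ^ 2 + 2 * ‖metricProj N x - altProj M N x - (q - p)‖ ^ 2
      ≤ ‖x - q‖ ^ 2 := by
  have hMne : M.Nonempty := ⟨p, h.mem_left⟩
  have hNne : N.Nonempty := ⟨q, h.mem_right⟩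
  have f1 := inner_sub_metricProj_nonpos hNne hNcl hNcv x h.mem_right
  have f2 := inner_sub_metricProj_nonpos hMne hMcl hMcv (metricProj N x) h.mem_left
  have f3 := inner_sub_metricProj_nonpos hMne hMcl hMcv (metricProj N x) hx
  have f4 := h.inner_right _ (metricProj_mem_nearestPoints hNne hNcl hNcv x).1
  have f5 := h.inner_left _ (altProj_mem hMne hMcl hMcv N x)
  change inner ℝ (metricProj N x - altProj M N x) (p - altProj M N x) ≤ 0 at f2
  change inner ℝ (metricProj N x - altProj M N x) (x - altProj M N x) ≤ 0 at f3
  -- After expansion, the claim is a linear combination of `f1`, …, `f6`.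
  have f6 : 0 ≤ inner ℝ (x - altProj M N x) (x - altProj M N x) := real_inner_self_nonneg
  generalize altProj M N x = b at *
  generalize metricProj N x = y at *
  simp only [← real_inner_self_eq_norm_sq]
  simp only [inner_sub_left, inner_sub_right, real_inner_comm y x, real_inner_comm b x,
    real_inner_comm q x, real_inner_comm b y, real_inner_comm p y,
    real_inner_comm q y, real_inner_comm p b, real_inner_comm q b, real_inner_comm q p] at *
  linarith

lemma infDist_altProj_le (hMne : M.Nonempty) (hMcl : IsClosed M) (hMcv : Convex ℝ M)
    (hNne : N.Nonempty) (hNcl : IsClosed N) (hNcv : Convex ℝ N) (hx : x ∈ M) :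
    Metric.infDist (altProj M N x) N ≤ Metric.infDist x N := by
  obtain ⟨hy, hxy⟩ := metricProj_mem_nearestPoints hNne hNcl hNcv x
  have hz := (metricProj_mem_nearestPoints hMne hMcl hMcv (metricProj N x)).2
  calc Metric.infDist (altProj M N x) N ≤ dist (altProj M N x) (metricProj N x) :=
        Metric.infDist_le_dist_of_mem hy
    _ = Metric.infDist (metricProj N x) M := by rw [dist_comm, dist_eq_norm]; exact hz
    _ ≤ dist (metricProj N x) x := Metric.infDist_le_dist_of_mem hx
    _ = Metric.infDist x N := by rw [dist_comm, dist_eq_norm]; exact hxy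

/-- The distances of the iterates to `N` decrease, so each of the `n` steps gains at least the square
belonging to the last one. -/
lemma IsProximalPair.iterate_altProj_bound (h : IsProximalPair M N p q)
    (hMcl : IsClosed M) (hMcv : Convex ℝ M) (hNcl : IsClosed N) (hNcv : Convex ℝ N) (hu : u ∈ M)
    (n : ℕ) :
    (altProj M N)^[n] u ∈ M ∧
    2 * n * (Metric.infDist ((altProj M N)^[n] u) N - ‖q - p‖) ^ 2
      + ‖(altProj M N)^[n] u - q‖ ^ 2 ≤ ‖u - q‖ ^ 2 := by
  have hMne : M.Nonempty := ⟨p, h.mem_left⟩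
  have hNne : N.Nonempty := ⟨q, h.mem_right⟩
  induction n with
  | zero => simpa using hu
  | succ n ih =>
    rw [Function.iterate_succ_apply']
    obtain ⟨hx, ih⟩ := ih
    generalize (altProj M N)^[n] u = x at *
    have hPx := altProj_mem hMne hMcl hMcv N x
    refine ⟨hPx, ?_⟩
    have h1 := h.norm_altProj_sub_sq_add_le hMcl hMcv hNcl hNcv hx
    have h2 := infDist_altProj_le hMne hMcl hMcv hNne hNcl hNcv hx
    have h3 := h.norm_le_infDist hPx
    have h4 : Metric.infDist (altProj M N x) N - ‖q - p‖
        ≤ ‖metricProj N x - altProj M N x - (q - p)‖ := by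
      have h5 : Metric.infDist (altProj M N x) N ≤ ‖metricProj N x - altProj M N x‖ := by
        rw [← dist_eq_norm, dist_comm]
        exact Metric.infDist_le_dist_of_mem (metricProj_mem_nearestPoints hNne hNcl hNcv x).1
      linarith [norm_sub_norm_le (metricProj N x - altProj M N x) (q - p)]
    have h6 := pow_le_pow_left₀ (sub_nonneg.2 h3) h4 2
    have h7 := pow_le_pow_left₀ (sub_nonneg.2 h3) (sub_le_sub_right h2 ‖q - p‖) 2
    have h8 := mul_le_mul_of_nonneg_left h7 (by positivity : (0 : ℝ) ≤ 2 * n)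
    push_cast
    linarith

end AltProj

/-! ### The Ishikawa step -/

lemma norm_convexCombo_sub_sq (a b c : X) (t : ℝ) :
    ‖(1 - t) • a + t • b - c‖ ^ 2
      = (1 - t) * ‖a - c‖ ^ 2 + t * ‖b - c‖ ^ 2 - t * (1 - t) * ‖a - b‖ ^ 2 := by
  have h1 : (1 - t) • a + t • b - c = (1 - t) • (a - c) + t • (b - c) := by module
  have h2 : a - b = (a - c) - (b - c) := by abel
  rw [h1, h2, norm_add_sq_real, norm_sub_sq_real (a - c), norm_smul, norm_smul,
    real_inner_smul_left, real_inner_smul_right, mul_pow, mul_pow, Real.norm_eq_abs,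
    Real.norm_eq_abs, sq_abs, sq_abs]
  ring

lemma norm_ishikawa_sub_sq_le {w z : X} {s t : ℝ} (hs : s ∈ Set.Icc (0 : ℝ) 1)
    (ht : t ∈ Set.Icc (0 : ℝ) 1) (hFM : Set.MapsTo F M M) (hMcv : Convex ℝ M)
    (hF : RelativelyNonexpansive M N F) (hq : q ∈ N) (hFq : F q = q) (hw : w ∈ M)
    (hz : z = (1 - t) • w + t • F w) :
    (1 - s) • w + s • F z ∈ M ∧
    ‖(1 - s) • w + s • F z - q‖ ^ 2 ≤ ‖w - q‖ ^ 2 - s * (t * (1 - t)) * ‖w - F w‖ ^ 2 := by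
  have hzM : z ∈ M := hz ▸ hMcv hw (hFM hw) (by linarith [ht.2]) ht.1 (by ring)
  refine ⟨hMcv hw (hFM hzM) (by linarith [hs.2]) hs.1 (by ring), ?_⟩
  have hFq' : ∀ x ∈ M, ‖F x - q‖ ^ 2 ≤ ‖x - q‖ ^ 2 := fun x hx => by
    have := hF x hx q hq
    rw [hFq] at this
    gcongr
  have h1 := hFq' w hw
  have h2 := hFq' z hzM
  rw [hz, norm_convexCombo_sub_sq, ← hz] at h2
  rw [norm_convexCombo_sub_sq]
  have h3 := mul_le_mul_of_nonneg_left h1 ht.1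
  have h4 : ‖F z - q‖ ^ 2 ≤ ‖w - q‖ ^ 2 - t * (1 - t) * ‖w - F w‖ ^ 2 := by linarith
  have h5 := mul_le_mul_of_nonneg_left h4 hs.1
  have h6 : 0 ≤ s * (1 - s) * ‖w - F z‖ ^ 2 :=
    mul_nonneg (mul_nonneg hs.1 (by linarith [hs.2])) (sq_nonneg _)
  linarith

/-! ### Convergence -/

/-- A sequence in `M` of approximate fixed points that approaches `N` as closely as `M` does, and is
Fejér monotone with respect to the fixed right points of proximal pairs, converges to a fixed point
if `F` has relatively compact range on `M`. No continuity of `F` is needed: relative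
nonexpansiveness is applied to the points of the sequence and the fixed point `b ∈ N`. -/
theorem exists_fixedPoint_tendsto_of_fejer [CompleteSpace X]
    (hMcl : IsClosed M) (hNcl : IsClosed N) (hNcv : Convex ℝ N)
    (hFM : Set.MapsTo F M M) (hFN : Set.MapsTo F N N)
    (hF : RelativelyNonexpansive M N F) (h : IsProximalPair M N p q)
    {w : ℕ → X} (hwM : ∀ n, w n ∈ M) (hwF : Tendsto (fun n => ‖w n - F (w n)‖) atTop (𝓝 0))
    (hdist : Tendsto (fun n => Metric.infDist (w n) N) atTop (𝓝 ‖q - p‖))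
    (hfejer : ∀ a b, IsProximalPair M N a b → F b = b → Antitone fun n => ‖w n - b‖ ^ 2)
    {K : Set X} (hK : IsCompact K) (hFK : F '' M ⊆ K) :
    ∃ a ∈ M, F a = a ∧ Tendsto w atTop (𝓝 a) := by
  obtain ⟨a, -, φ, hφ, hFa⟩ := hK.tendsto_subseq (x := fun n => F (w n))
    (fun n => hFK ⟨w n, hwM n, rfl⟩)
  have hwa : Tendsto (w ∘ φ) atTop (𝓝 a) := by
    have h1 := (tendsto_zero_iff_norm_tendsto_zero.2 hwF).comp hφ.tendsto_atTop
    simpa [Function.comp_def] using h1.add hFa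
  have haM : a ∈ M := hMcl.mem_of_tendsto hwa (Eventually.of_forall fun n => hwM _)
  have haN : Metric.infDist a N = ‖q - p‖ :=
    tendsto_nhds_unique (((Metric.continuous_infDist_pt N).tendsto a).comp hwa)
      (hdist.comp hφ.tendsto_atTop)
  obtain ⟨hbN, hab⟩ := metricProj_mem_nearestPoints ⟨q, h.mem_right⟩ hNcl hNcv a
  set b := metricProj N a
  have hpair : IsProximalPair M N a b := h.of_norm_le haM hbN (by rw [norm_sub_rev, hab, haN])
  have hFb : F b = b := by
    have h1 : ‖a - F b‖ ≤ ‖a - b‖ :=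
      le_of_tendsto_of_tendsto' (hFa.sub_const (F b)).norm (hwa.sub_const b).norm
        fun n => hF _ (hwM _) _ hbN
    have h2 := hpair.sub_eq haM (hFN hbN) (by rwa [norm_sub_rev, norm_sub_rev b])
    exact sub_left_injective h2
  have hFa' : F a = a := by
    have h1 := hF a haM b hbN
    rw [hFb] at h1
    have h2 := hpair.sub_eq (hFM haM) hbN (by rwa [norm_sub_rev, norm_sub_rev b])
    exact sub_right_injective h2
  refine ⟨a, haM, hFa', ?_⟩
  have hlim : Tendsto (fun n => ‖w n - b‖ ^ 2) atTop (𝓝 (‖a - b‖ ^ 2)) :=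
    (tendsto_iff_tendsto_subseq_of_antitone (hfejer a b hpair hFb) hφ.tendsto_atTop).2
      ((hwa.sub_const b).norm.pow 2)
  have hsq : Tendsto (fun n => ‖w n - a‖ ^ 2) atTop (𝓝 0) := by
    refine squeeze_zero (fun n => sq_nonneg _) (fun n => ?_)
      (sub_self (‖a - b‖ ^ 2) ▸ hlim.sub_const (‖a - b‖ ^ 2))
    have := hpair.norm_sub_sq_add_le (hwM n)
    rw [norm_sub_rev b] at this
    linarith
  rw [tendsto_iff_norm_sub_tendsto_zero]
  simpa using hsq.sqrt

/-- Convergence of the Ishikawa iteration with alternating projections, over a real Hilbert space. -/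
theorem ishikawa_altProj_tendsto [CompleteSpace X]
    (hMne : M.Nonempty) (hMbd : Bornology.IsBounded M) (hMcl : IsClosed M) (hMcv : Convex ℝ M)
    (hNne : N.Nonempty) (hNcl : IsClosed N) (hNcv : Convex ℝ N)
    (hFM : Set.MapsTo F M M) (hFN : Set.MapsTo F N N) (hF : RelativelyNonexpansive M N F)
    {ε : ℝ} (hε : 0 < ε) {η δ : ℕ → ℝ} (hη : ∀ n, η n ∈ Set.Ioo ε (1 - ε))
    (hδ : ∀ n, δ n ∈ Set.Ioo ε (1 - ε)) {w z : ℕ → X} (hw0 : w 0 ∈ M)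
    (hz : ∀ n, z n = (1 - δ n) • w n + δ n • F (w n))
    (hw : ∀ n, w (n + 1) = (altProj M N)^[n] ((1 - η n) • w n + η n • F (z n))) :
    Tendsto (fun n => ‖w n - F (w n)‖) atTop (𝓝 0) ∧
      ((∃ K : Set X, IsCompact K ∧ F '' M ⊆ K) →
        ∃ a ∈ M, F a = a ∧ Tendsto w atTop (𝓝 a)) := by
  have hIcc : ∀ t ∈ Set.Ioo ε (1 - ε), t ∈ Set.Icc (0 : ℝ) 1 := fun t ht =>
    ⟨by linarith [ht.1], by linarith [ht.2]⟩
  have hstep : ∀ a b, IsProximalPair M N a b → F b = b → ∀ n, w n ∈ M →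
      w (n + 1) ∈ M ∧
      2 * n * (Metric.infDist (w (n + 1)) N - ‖b - a‖) ^ 2 + ‖w (n + 1) - b‖ ^ 2
        ≤ ‖w n - b‖ ^ 2 - η n * (δ n * (1 - δ n)) * ‖w n - F (w n)‖ ^ 2 := by
    intro a b hab hFb n hn
    obtain ⟨hu, hle⟩ := norm_ishikawa_sub_sq_le (hIcc _ (hη n)) (hIcc _ (hδ n)) hFM hMcv hF
      hab.mem_right hFb hn (hz n)
    have h1 := hab.iterate_altProj_bound hMcl hMcv hNcl hNcv hu n
    rw [← hw n] at h1
    exact ⟨h1.1, h1.2.trans hle⟩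
  obtain ⟨p, q, hpq, -, hFq⟩ :=
    exists_isProximalPair_fixed hMne hMbd hMcl hMcv hNne hNcl hNcv hFM hFN hF
  have hwM : ∀ n, w n ∈ M := fun n => by
    induction n with
    | zero => exact hw0
    | succ n ih => exact (hstep p q hpq hFq n ih).1
  have hcoef : ∀ n, ε ^ 3 ≤ η n * (δ n * (1 - δ n)) := fun n => by
    have h1 := (hη n).1.le
    have h2 := (hδ n).1.le
    have h0 : 0 ≤ η n := hε.le.trans h1
    have h0' : 0 ≤ δ n := hε.le.trans h2
    have h3 : ε ≤ 1 - δ n := by linarith [(hδ n).2]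
    calc ε ^ 3 = ε * (ε * ε) := by ring
      _ ≤ _ := by gcongr
  have hdec : ∀ a b, IsProximalPair M N a b → F b = b → ∀ n,
      2 * n * (Metric.infDist (w (n + 1)) N - ‖b - a‖) ^ 2
        + ε ^ 3 * ‖w n - F (w n)‖ ^ 2 ≤ ‖w n - b‖ ^ 2 - ‖w (n + 1) - b‖ ^ 2 := by
    intro a b hab hFb n
    have h1 := (hstep a b hab hFb n (hwM n)).2
    have h2 := mul_le_mul_of_nonneg_right (hcoef n) (sq_nonneg ‖w n - F (w n)‖)
    linarith
  have hanti : ∀ a b, IsProximalPair M N a b → F b = b → Antitone fun n => ‖w n - b‖ ^ 2 := by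
    refine fun a b hab hFb => antitone_nat_of_succ_le fun n => ?_
    have h1 := hdec a b hab hFb n
    have h2 : 0 ≤ 2 * n * (Metric.infDist (w (n + 1)) N - ‖b - a‖) ^ 2
        + ε ^ 3 * ‖w n - F (w n)‖ ^ 2 := by positivity
    linarith
  have hlim := tendsto_atTop_ciInf (hanti p q hpq hFq)
    ⟨0, by rintro _ ⟨n, rfl⟩; exact sq_nonneg _⟩
  have hdiff : Tendsto (fun n => ‖w n - q‖ ^ 2 - ‖w (n + 1) - q‖ ^ 2) atTop (𝓝 0) := by
    simpa using hlim.sub (hlim.comp (tendsto_add_atTop_nat 1))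
  have hwF : Tendsto (fun n => ‖w n - F (w n)‖) atTop (𝓝 0) := by
    have h1 : Tendsto (fun n => ‖w n - F (w n)‖ ^ 2) atTop (𝓝 0) := by
      refine squeeze_zero (fun n => sq_nonneg _) (fun n => ?_)
        (by simpa using hdiff.div_const (ε ^ 3))
      rw [le_div_iff₀' (by positivity)]
      have h2 := hdec p q hpq hFq n
      have h3 : 0 ≤ 2 * n * (Metric.infDist (w (n + 1)) N - ‖q - p‖) ^ 2 := by positivity
      linarith
    simpa using h1.sqrt
  refine ⟨hwF, fun ⟨K, hK, hFK⟩ => ?_⟩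
  have hdist : Tendsto (fun n => Metric.infDist (w n) N) atTop (𝓝 ‖q - p‖) := by
    -- The bound on the distance of `w (n + 1)` has the factor `n`, which is bounded below by `1` only
    -- from `n = 1` on.
    rw [← tendsto_add_atTop_iff_nat 2]
    have h1 : Tendsto (fun n => (Metric.infDist (w (n + 2)) N - ‖q - p‖) ^ 2) atTop (𝓝 0) := by
      refine squeeze_zero (fun n => sq_nonneg _) (fun n => ?_)
        (hdiff.comp (tendsto_add_atTop_nat 1))
      have h2 := hdec p q hpq hFq (n + 1)
      have h3 : 0 ≤ ε ^ 3 * ‖w (n + 1) - F (w (n + 1))‖ ^ 2 := by positivity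
      have h4 : 0 ≤ (n : ℝ) * (Metric.infDist (w (n + 1 + 1)) N - ‖q - p‖) ^ 2 := by positivity
      have h5 := sq_nonneg (Metric.infDist (w (n + 1 + 1)) N - ‖q - p‖)
      push_cast at h2
      change (Metric.infDist (w (n + 1 + 1)) N - ‖q - p‖) ^ 2 ≤
        ‖w (n + 1) - q‖ ^ 2 - ‖w (n + 1 + 1) - q‖ ^ 2
      linarith
    have h2 : Tendsto (fun n => Metric.infDist (w (n + 2)) N - ‖q - p‖) atTop (𝓝 0) := by
      have h3 := h1.sqrt
      simp only [Real.sqrt_sq_eq_abs, Real.sqrt_zero] at h3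
      exact tendsto_zero_iff_abs_tendsto_zero _ |>.2 h3
    simpa using h2.add_const ‖q - p‖
  exact exists_fixedPoint_tendsto_of_fejer hMcl hNcl hNcv hFM hFN hF hpq hwM hwF hdist hanti hK hFK

end RealHilbert

theorem theorem2p2 (𝕜 : Type*) [RCLike 𝕜] {X : Type*} [NormedAddCommGroup X]
    [InnerProductSpace 𝕜 X] [NormedSpace ℝ X] [IsScalarTower ℝ 𝕜 X] [CompleteSpace X]
    (M N : Set X)
    (hMne : M.Nonempty) (hMbd : Bornology.IsBounded M) (hMcl : IsClosed M) (hMcv : Convex ℝ M)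
    (hNne : N.Nonempty) (hNbd : Bornology.IsBounded N) (hNcl : IsClosed N) (hNcv : Convex ℝ N)
    (F : X → X) (hFM : Set.MapsTo F M M) (hFN : Set.MapsTo F N N)
    (hF : RelativelyNonexpansive M N F)
    (ε : ℝ) (hε : ε ∈ Set.Ioo (0 : ℝ) (1 / 2))
    (η δ : ℕ → ℝ) (hη : ∀ n, η n ∈ Set.Ioo ε (1 - ε)) (hδ : ∀ n, δ n ∈ Set.Ioo ε (1 - ε))
    (w z : ℕ → X) (hw0 : w 0 ∈ M)
    (hz : ∀ n, z n = (1 - δ n) • w n + δ n • F (w n))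
    (hw : ∀ n, w (n + 1) = (altProj M N)^[n] ((1 - η n) • w n + η n • F (z n))) :
    Tendsto (fun n => ‖w n - F (w n)‖) atTop (𝓝 0) ∧
      ((∃ K : Set X, IsCompact K ∧ F '' M ⊆ K) →
        Tendsto (fun n => ‖w n - F (z n)‖) atTop (𝓝 0) →
          ∃ p ∈ M, F p = p ∧ Tendsto w atTop (𝓝 p)) := by
  -- The real inner product is built on the given real normed space structure, so that the real
  -- scalar multiplication in the hypotheses stays the same.
  let _ : InnerProductSpace ℝ X :=
    { (inferInstance : NormedSpace ℝ X) with
      inner := fun x y => RCLike.re (inner 𝕜 x y)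
      norm_sq_eq_re_inner := fun x => by
        simp
      conj_inner_symm := fun x y => by
        simpa using inner_re_symm (𝕜 := 𝕜) y x
      add_left := fun x y z => by simp [inner_add_left]
      smul_left := fun x y r => by
        rw [← algebraMap_smul 𝕜 r x, inner_smul_left]
        simp [RCLike.algebraMap_eq_ofReal] }
  have h := ishikawa_altProj_tendsto hMne hMbd hMcl hMcv hNne hNcl hNcv hFM hFN hF hε.1 hη hδ
    hw0 hz hw
  exact ⟨h.1, fun hK _ => h.2 hK⟩
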